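/- Let $\mathcal H$ be a separable (possibly finite-dimensional) complex Hilbert space, let $X$ be a locally compact Hausdorff space with its Borel $\sigma$-algebra $\mathcal O(X)$, and let $\mathcal S(\mathcal H)$ be the set of density operators (positive operators of trace one) on $\mathcal H$. Let $\nu:\mathcal O(X)\to\mathcal B(\mathcal H)$ be a positive operator-valued measure, i.e. $\nu(E)\ge 0$ for all $E$ and $\nu$ is ultraweakly countably additive: $\operatorname{tr}\big(s\,\nu(\bigcup_k E_k)\big)=\sum_k \operatorname{tr}(s\,\nu(E_k))$ for all disjoint Borel sets $E_1,E_2,\dots$ and all $s\in\mathcal S(\mathcal H)$. Let $\rho\in\mathcal S(\mathcal H)$ be of full rank (injective) and let $\nu_\rho(E)=\operatorname{tr}(\rho\,\nu(E))$, a finite positive Borel measure. A quantum random variable is a function $f:X\to\mathcal B(\mathcal H)$ such that $x\mapsto\operatorname{tr}(sf(x))$ is Borel measurable for every $s\in\mathcal S(\mathcal H)$; $\mathcal L_{\mathcal H}(X,\nu)$ denotes the complex linear span of the positive quantum random variables. Assume that $\nu$ has a Radon-Nikodým derivative $D=\frac{d\nu}{d\nu_\rho}$ which is a quantum random variable (with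 values in the bounded operators); that is, for an orthonormal basis $(e_i)$ of $\mathcal H$ the entries $\langle D(\cdot)e_j,e_i\rangle$ are $\nu_\rho$-integrable and $\int_E\langle D(x)e_j,e_i\rangle\,d\nu_\rho(x)=\langle\nu(E)e_j,e_i\rangle$ for all $i,j$ and all Borel sets $E$. For $A\in\mathcal B(\mathcal H)$ let $\|A\|_{S^p}=\operatorname{tr}(|A|^p)^{1/p}\in[0,\infty]$ for $1\le p<\infty$ and let $\|A\|_{S^\infty}$ be the operator norm. For $f\in\mathcal L_{\mathcal H}(X,\nu)$ and $p,q\in[1,\infty]$ put \[ \|f\|_{S^p,L^q}=\sup_{s\in\mathcal S(\mathcal H)}\Big\|\,\big\|s^{1/2}D^{1/2}fD^{1/2}s^{1/2}\big\|_{S^p}\Big\|_{L^q(X,\nu_\rho)}\in[0,\infty]. \] If $f,g\in\mathcal L_{\mathcal H}(X,\nu)$ and $p,q\in[1,\infty]$ satisfy $\frac1p+\frac1q=1$, then (with $0\cdot\infty=0$) \[ \sup_{s\in\mathcal S(\mathcal H)}\Big\|\,\big\|s^{1/2}D^{1/2}fD^{1/2}\,s\,D^{1/2}gD^{1/2}s^{1/2}\big\|_{S^1}\Big\|_{L^1(X,\nu_\rho)}\le\|f\|_{S^p,L^p}\,\|g\|_{S^q,L^q}.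 \] -/

import Mathlib

open MeasureTheory
open scoped ENNReal InnerProductSpace

namespace OpLp

noncomputable section

section Trace

variable (H : Type*) [NormedAddCommGroup H] [InnerProductSpace ℂ H] [CompleteSpace H]

/-- A fixed orthonormal basis of the Hilbert space, in which traces are computed. (The trace of a
trace class operator, and the extended trace of a positive operator, do not depend on it.) -/
def onb : HilbertBasis (exists_hilbertBasis ℂ H).choose ℂ H :=
  (exists_hilbertBasis ℂ H).choose_spec.choose

variable {H}

/-- The trace `∑ i, ⟨A e_i, e_i⟩`; it is only ever applied to trace class operators. -/
def tr (A : H →L[ℂ] H) : ℂ := ∑' i, ⟪onb H i, A (onb H i)⟫_ℂ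

/-- The `[0, ∞]`-valued trace of a positive operator. -/
def posTr (A : H →L[ℂ] H) : ℝ≥0∞ := ∑' i, ENNReal.ofReal (⟪onb H i, A (onb H i)⟫_ℂ).re

/-- The Schatten norm `(tr |A|^p)^(1/p)`, with values in `[0, ∞]`; for `p = ∞` the operator norm. -/
def schattenNorm (p : ℝ≥0∞) (A : H →L[ℂ] H) : ℝ≥0∞ :=
  if p = ∞ then ‖A‖ₑ else (posTr (CFC.abs A ^ p.toReal)) ^ (1 / p.toReal)

variable (H) in
/-- The density operators (states): positive operators of trace one. (If `tr s = 1`, then the series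
defining the trace converges, as the value of a divergent sum is `0`.) -/
def densityOperators : Set (H →L[ℂ] H) := {s | 0 ≤ s ∧ tr s = 1}

end Trace

section HelperFacts

variable {H : Type*} [NormedAddCommGroup H] [InnerProductSpace ℂ H] [CompleteSpace H]

lemma sqrt_adjoint_apply (s : H →L[ℂ] H) (u v : H) :
    ⟪CFC.sqrt s u, v⟫_ℂ = ⟪u, CFC.sqrt s v⟫_ℂ := by
  have h : IsSelfAdjoint (CFC.sqrt s) := (CFC.sqrt_nonneg s).isSelfAdjoint
  rw [← ContinuousLinearMap.adjoint_inner_right, ← ContinuousLinearMap.star_eq_adjoint, h.star_eq]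

/-- `tr (ρ A) ≥ 0` for a density operator `ρ` and a positive operator `A`. -/
lemma tr_mul_re_nonneg {ρ A : H →L[ℂ] H} (hρ : ρ ∈ densityOperators H) (hA : 0 ≤ A) :
    0 ≤ (tr (ρ * A)).re := by
  obtain ⟨hρ0, hρ1⟩ := hρ
  set b := onb H with hb
  set r := CFC.sqrt ρ with hr
  have hrr : r * r = ρ := CFC.sqrt_mul_sqrt_self ρ hρ0
  have hAsa : ∀ u v : H, ⟪A u, v⟫_ℂ = ⟪u, A v⟫_ℂ := by
    intro u v
    rw [← ContinuousLinearMap.adjoint_inner_right, ← ContinuousLinearMap.star_eq_adjoint,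
      hA.isSelfAdjoint.star_eq]
  have hsum1 : Summable fun i => ⟪b i, ρ (b i)⟫_ℂ := by
    by_contra h
    have : tr ρ = 0 := tsum_eq_zero_of_not_summable h
    rw [this] at hρ1
    exact zero_ne_one hρ1
  have hsq : ∀ i, (‖r (b i)‖ ^ 2 : ℝ) = (⟪b i, ρ (b i)⟫_ℂ).re := by
    intro i
    rw [← hrr, mul_apply_eq_comp, ← sqrt_adjoint_apply, ← hr,
      inner_self_eq_norm_sq_to_K]
    norm_cast
  have hS : Summable fun i => ‖r (b i)‖ ^ 2 := by
    simp_rw [hsq]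
    exact (Complex.hasSum_re hsum1.hasSum).summable
  have hpars : ∀ v : H, HasSum (fun k => ‖⟪b k, v⟫_ℂ‖ ^ 2) (‖v‖ ^ 2) := by
    intro v
    have h := Complex.hasSum_re (b.hasSum_inner_mul_inner v v)
    rw [inner_self_eq_norm_sq_to_K] at h
    convert h using 1
    · funext k
      rw [← inner_conj_symm v (b k), RCLike.conj_mul]
      norm_cast
    · norm_cast
  have hD : ∀ v : (exists_hilbertBasis ℂ H).choose → H, (Summable fun k => ‖v k‖ ^ 2) →
      Summable fun z : (exists_hilbertBasis ℂ H).choose × (exists_hilbertBasis ℂ H).choose =>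
        ‖⟪b z.2, v z.1⟫_ℂ‖ ^ 2 := by
    intro v hv
    refine (summable_prod_of_nonneg fun z => by positivity).2
      ⟨fun k => (hpars (v k)).summable, ?_⟩
    simpa only [(hpars _).tsum_eq] using hv
  have hS2 : Summable fun k => ‖A (r (b k))‖ ^ 2 := by
    refine Summable.of_nonneg_of_le (fun k => by positivity) (fun k => ?_) (hS.mul_left (‖A‖ ^ 2))
    rw [← mul_pow]
    gcongr
    exact A.le_opNorm _
  set F : (exists_hilbertBasis ℂ H).choose → (exists_hilbertBasis ℂ H).choose → ℂ :=
    fun k i => ⟪A (r (b k)), b i⟫_ℂ * ⟪b i, r (b k)⟫_ℂ with hF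
  have hFs : Summable (Function.uncurry F) := by
    refine Summable.of_norm_bounded ((hD _ hS2).add (hD _ hS)) ?_
    rintro ⟨k, i⟩
    simp only [Function.uncurry, hF, norm_mul]
    rw [← inner_conj_symm, RCLike.norm_conj]
    nlinarith [sq_nonneg (‖⟪b i, A (r (b k))⟫_ℂ‖ - ‖⟪b i, r (b k)⟫_ℂ‖),
      sq_nonneg (‖⟪b i, A (r (b k))⟫_ℂ‖), sq_nonneg (‖⟪b i, r (b k)⟫_ℂ‖)]
  have h1 : ∀ k, ∑' i, F k i = ⟪A (r (b k)), r (b k)⟫_ℂ := fun k =>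
    b.tsum_inner_mul_inner _ _
  have h2 : ∀ i, ∑' k, F k i = ⟪b i, (ρ * A) (b i)⟫_ℂ := by
    intro i
    have : ⟪b i, (ρ * A) (b i)⟫_ℂ = ⟪r (b i), r (A (b i))⟫_ℂ := by
      rw [← hrr, sqrt_adjoint_apply]; rfl
    rw [this, ← b.tsum_inner_mul_inner]
    refine tsum_congr fun k => ?_
    simp only [hF]
    rw [hAsa, sqrt_adjoint_apply, ← sqrt_adjoint_apply ρ (b i), mul_comm]
  have h3 : tr (ρ * A) = ∑' k, ⟪A (r (b k)), r (b k)⟫_ℂ := by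
    calc tr (ρ * A) = ∑' i, ∑' k, F k i := (tsum_congr h2).symm
      _ = ∑' k, ∑' i, F k i := hFs.tsum_comm
      _ = _ := tsum_congr h1
  rw [h3, Complex.re_tsum]
  · refine tsum_nonneg fun k => ?_
    have h := ((ContinuousLinearMap.nonneg_iff_isPositive A).1 hA).re_inner_nonneg_left (r (b k))
    exact h
  · have h := hFs.prod
    simp only [Function.uncurry_apply_pair, h1] at h
    exact h

end HelperFacts

section Measure

variable (X : Type*) [MeasurableSpace X]
  (H : Type*) [NormedAddCommGroup H] [InnerProductSpace ℂ H] [CompleteSpace H]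

/-- A positive operator-valued measure: an ultraweakly countably additive map from the measurable
sets to the positive operators. (Values on non-measurable sets are irrelevant.) -/
structure POVM where
  /-- The operator assigned to a set. -/
  toFun : Set X → (H →L[ℂ] H)
  nonneg : ∀ E, MeasurableSet E → 0 ≤ toFun E
  hasSum_tr : ∀ E : ℕ → Set X, (∀ k, MeasurableSet (E k)) → Pairwise (Function.onFun Disjoint E) →
    ∀ s ∈ densityOperators H, HasSum (fun k => tr (s * toFun (E k))) (tr (s * toFun (⋃ k, E k)))

variable {X H}

/-- The scalar measure `ν_ρ(E) = tr (ρ ν(E))`. -/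
def POVM.scalar (ν : POVM X H) (ρ : H →L[ℂ] H) (hρ : ρ ∈ densityOperators H) : Measure X :=
  Measure.ofMeasurable (fun E _ => ENNReal.ofReal (tr (ρ * ν.toFun E)).re)
    (by
      have h := (ν.hasSum_tr (fun _ => ∅) (fun _ => MeasurableSet.empty)
        (fun _ _ _ => disjoint_bot_left) ρ hρ).summable
      have h0 : tr (ρ * ν.toFun ∅) = 0 := (summable_const_iff _).1 h
      simp [h0])
    (by
      intro E hE hd
      have h := Complex.hasSum_re (ν.hasSum_tr E hE hd ρ hρ)
      rw [← h.tsum_eq]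
      exact ENNReal.ofReal_tsum_of_nonneg
        (fun k => tr_mul_re_nonneg hρ (ν.nonneg _ (hE k))) h.summable)

/-- A quantum random variable: `x ↦ tr (s f(x))` is measurable for every density operator `s`. -/
def IsQuantumRandomVariable (f : X → H →L[ℂ] H) : Prop :=
  ∀ s ∈ densityOperators H, Measurable fun x => tr (s * f x)

variable (X H) in
/-- The linear span of the positive quantum random variables. -/
def spanPositive : Submodule ℂ (X → H →L[ℂ] H) :=
  Submodule.span ℂ {f | IsQuantumRandomVariable f ∧ ∀ x, 0 ≤ f x}

/-- `D` is (a version of) the Radon-Nikodým derivative `dν/dμ`: a quantum random variable, with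
values in the bounded operators, whose matrix entries `⟨D e_j, e_i⟩` in the orthonormal basis `e`
are integrable densities with respect to `μ` of the complex measures `E ↦ ⟨ν(E) e_j, e_i⟩`. -/
structure POVM.IsRNDeriv {ι : Type*} (ν : POVM X H) (μ : Measure X) (e : HilbertBasis ι ℂ H)
    (D : X → H →L[ℂ] H) : Prop where
  isQuantumRandomVariable : IsQuantumRandomVariable D
  integrable : ∀ i j, Integrable (fun x => ⟪e i, D x (e j)⟫_ℂ) μ
  setIntegral_eq : ∀ i j, ∀ E, MeasurableSet E →
    ∫ x in E, ⟪e i, D x (e j)⟫_ℂ ∂μ = ⟪e i, ν.toFun E (e j)⟫_ℂ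

/-- The norm `‖f‖_{S^p, L^q}`: the supremum over the density operators `s` of the `L^q(μ)` norm of
the Schatten `p`-norm of `s^{1/2} D^{1/2} f D^{1/2} s^{1/2}`. -/
def schattenLpNorm (p q : ℝ≥0∞) (μ : Measure X) (D f : X → H →L[ℂ] H) : ℝ≥0∞ :=
  ⨆ s ∈ densityOperators H, eLpNorm (fun x => schattenNorm p
    (CFC.sqrt s * CFC.sqrt (D x) * f x * CFC.sqrt (D x) * CFC.sqrt s)) q μ

end Measure

end

end OpLp

/-!
Write `r = s^{1/2}`, `F = D^{1/2} f D^{1/2}` and `G = D^{1/2} g D^{1/2}`, so that the integrand on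
the left is `‖(r F r) (r G r)‖_{S^1}`. As `s` has trace one, `r` is Hilbert–Schmidt, hence
`A = r F r` and `B = r G r` are compact. Take polar decompositions `A = U |A|`, `B = V |B|` and
`|A B| = C A B`. If `y`, `w` are eigenbases of `|A|`, `|B|` with eigenvalues `a`, `b`, then
`tr |A B| = ∑ a_k b_l ⟨w_l, C U y_k⟩ ⟨y_k, V w_l⟩`, and the moduli of the products of inner products
form a doubly substochastic matrix; this gives `‖A B‖_{S^1} ≤ ‖A‖_{S^p} ‖B‖_{S^q}`. The theorem
follows by the Hölder inequality for `ν_ρ`. The functions being integrated are measurable because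
the continuous functional calculus is a pointwise limit of polynomials.
-/

namespace OpLp

noncomputable section

section Holder

variable {α β γ : Type*} [MeasurableSpace α] [MeasurableSpace β] [MeasurableSpace γ]

lemma lintegral_mul_le_eLpNorm_top_mul_eLpNorm_one {μ : Measure α} (a : α → ℝ≥0∞)
    {b : α → ℝ≥0∞} (hb : AEMeasurable b μ) :
    ∫⁻ x, a x * b x ∂μ ≤ eLpNorm a ∞ μ * eLpNorm b 1 μ :=
  calc ∫⁻ x, a x * b x ∂μ ≤ ∫⁻ x, eLpNorm a ∞ μ * b x ∂μ := by
        refine lintegral_mono_ae ?_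
        filter_upwards [enorm_ae_le_eLpNormEssSup a μ] with x hx
        gcongr
        simpa using hx
    _ = eLpNorm a ∞ μ * eLpNorm b 1 μ := by
        simp only [lintegral_const_mul'' _ hb, eLpNorm_one_eq_lintegral_enorm, enorm_eq_self]

lemma lintegral_mul_le_eLpNorm_mul_eLpNorm {μ : Measure α} {a b : α → ℝ≥0∞}
    (ha : AEMeasurable a μ) (hb : AEMeasurable b μ) (p q : ℝ≥0∞) [p.HolderConjugate q] :
    ∫⁻ x, a x * b x ∂μ ≤ eLpNorm a p μ * eLpNorm b q μ := by
  obtain rfl | hp := eq_or_ne p ∞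
  · obtain rfl : q = 1 := (ENNReal.HolderConjugate.eq_top_iff_eq_one ∞ q).1 rfl
    exact lintegral_mul_le_eLpNorm_top_mul_eLpNorm_one a hb
  obtain rfl | hq := eq_or_ne q ∞
  · obtain rfl : p = 1 := (ENNReal.HolderConjugate.eq_top_iff_eq_one ∞ p).1 rfl
    simpa only [mul_comm] using lintegral_mul_le_eLpNorm_top_mul_eLpNorm_one b ha
  have hpq := ENNReal.HolderConjugate.toReal_of_ne_top hp hq
  simpa only [eLpNorm_eq_lintegral_rpow_enorm_toReal (ENNReal.HolderConjugate.ne_zero p q) hp,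
    eLpNorm_eq_lintegral_rpow_enorm_toReal (ENNReal.HolderConjugate.ne_zero q p) hq, enorm_eq_self,
    Pi.mul_apply] using ENNReal.lintegral_mul_le_Lp_mul_Lq μ hpq ha hb

lemma lintegral_comp_mul_comp_le {m : Measure α} {μ : Measure β} {ν : Measure γ} {φ : α → β}
    {ψ : α → γ} (hφ : Measurable φ) (hψ : Measurable ψ) (hμ : m.map φ ≤ μ) (hν : m.map ψ ≤ ν)
    {a : β → ℝ≥0∞} {b : γ → ℝ≥0∞} (ha : Measurable a) (hb : Measurable b) (p q : ℝ≥0∞)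
    [p.HolderConjugate q] :
    ∫⁻ x, a (φ x) * b (ψ x) ∂m ≤ eLpNorm a p μ * eLpNorm b q ν :=
  calc ∫⁻ x, a (φ x) * b (ψ x) ∂m
      ≤ eLpNorm (a ∘ φ) p m * eLpNorm (b ∘ ψ) q m :=
        lintegral_mul_le_eLpNorm_mul_eLpNorm (ha.comp hφ).aemeasurable (hb.comp hψ).aemeasurable p q
    _ = eLpNorm a p (m.map φ) * eLpNorm b q (m.map ψ) := by
        rw [eLpNorm_map_measure ha.aestronglyMeasurable hφ.aemeasurable,
          eLpNorm_map_measure hb.aestronglyMeasurable hψ.aemeasurable]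
    _ ≤ eLpNorm a p μ * eLpNorm b q ν := by gcongr

lemma tsum_tsum_mul_mul_le_of_substochastic [DiscreteMeasurableSpace β] [DiscreteMeasurableSpace γ]
    {w : β → γ → ℝ≥0∞} (hrow : ∀ k, ∑' l, w k l ≤ 1) (hcol : ∀ l, ∑' k, w k l ≤ 1)
    (a : β → ℝ≥0∞) (b : γ → ℝ≥0∞) (p q : ℝ≥0∞) [p.HolderConjugate q] :
    ∑' k, ∑' l, a k * b l * w k l ≤ eLpNorm a p .count * eLpNorm b q .count := by
  -- Hölder for the measure on `β × γ` with weights `w`: its marginals are at most `count`.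
  let _ : MeasurableSpace (β × γ) := ⊤
  set m : Measure (β × γ) := Measure.count.withDensity fun z => w z.1 z.2
  have lintegral_m (u : β × γ → ℝ≥0∞) : ∫⁻ z, u z ∂m = ∑' k, ∑' l, u (k, l) * w k l := by
    rw [lintegral_withDensity_eq_lintegral_mul _ measurable_from_top measurable_from_top,
      lintegral_count, ENNReal.tsum_prod']
    simp only [Pi.mul_apply, mul_comm]
  have map_fst : m.map Prod.fst ≤ .count := Measure.le_iff.2 fun s hs => by
    rw [← lintegral_indicator_one hs, ← lintegral_indicator_one hs,
      lintegral_map .of_discrete measurable_from_top, lintegral_m, lintegral_count]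
    simp only [ENNReal.tsum_mul_left]
    exact ENNReal.tsum_le_tsum fun k => mul_le_of_le_one_right' (hrow k)
  have map_snd : m.map Prod.snd ≤ .count := Measure.le_iff.2 fun s hs => by
    rw [← lintegral_indicator_one hs, ← lintegral_indicator_one hs,
      lintegral_map .of_discrete measurable_from_top, lintegral_m, lintegral_count,
      ENNReal.tsum_comm]
    simp only [ENNReal.tsum_mul_left]
    exact ENNReal.tsum_le_tsum fun l => mul_le_of_le_one_right' (hcol l)
  rw [← lintegral_m fun z => a z.1 * b z.2]
  exact lintegral_comp_mul_comp_le measurable_from_top measurable_from_top map_fst map_snd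
    .of_discrete .of_discrete p q

lemma tsum_mul_le_rpow_mul_rpow {ι : Type*} (a b : ι → ℝ≥0∞) :
    ∑' i, a i * b i ≤ (∑' i, a i ^ 2) ^ (1 / 2 : ℝ) * (∑' i, b i ^ 2) ^ (1 / 2 : ℝ) := by
  let _ : MeasurableSpace ι := ⊤
  simpa only [lintegral_count, Pi.mul_apply, ENNReal.rpow_ofNat] using
    ENNReal.lintegral_mul_le_Lp_mul_Lq (Measure.count : Measure ι) Real.HolderConjugate.two_two
      (f := a) (g := b) measurable_from_top.aemeasurable measurable_from_top.aemeasurable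

end Holder

section HilbertSpace

open Filter Topology

variable {𝕜 E F G ι : Type*} [RCLike 𝕜] [NormedAddCommGroup E] [InnerProductSpace 𝕜 E]
  [NormedAddCommGroup F] [InnerProductSpace 𝕜 F] [NormedAddCommGroup G] [NormedSpace 𝕜 G]

lemma tsum_enorm_inner_sq (b : HilbertBasis ι 𝕜 E) (v : E) :
    ∑' i, ‖⟪b i, v⟫_𝕜‖ₑ ^ 2 = ‖v‖ₑ ^ 2 := by
  have hasSum_norm_sq : HasSum (fun i => ‖⟪b i, v⟫_𝕜‖ ^ 2) (‖v‖ ^ 2) := by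
    simpa [b.repr_apply_apply] using lp.hasSum_norm (by norm_num) (b.repr v)
  simp only [← ofReal_norm, ← ENNReal.ofReal_pow (norm_nonneg _)]
  rw [← ENNReal.ofReal_tsum_of_nonneg (fun _ => by positivity) hasSum_norm_sq.summable,
    hasSum_norm_sq.tsum_eq]

lemma tsum_enorm_inner_mul_enorm_inner_le (b : HilbertBasis ι 𝕜 E) (u v : E) :
    ∑' i, ‖⟪u, b i⟫_𝕜‖ₑ * ‖⟪b i, v⟫_𝕜‖ₑ ≤ ‖u‖ₑ * ‖v‖ₑ := by
  have hsymm (i : ι) : ‖⟪u, b i⟫_𝕜‖ₑ = ‖⟪b i, u⟫_𝕜‖ₑ := by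
    rw [← ofReal_norm, norm_inner_symm, ofReal_norm]
  have hsqrt (r : ℝ≥0∞) : (r ^ 2) ^ (1 / 2 : ℝ) = r := by
    rw [← ENNReal.rpow_natCast_mul]; norm_num
  simpa only [hsymm, tsum_enorm_inner_sq, hsqrt] using
    tsum_mul_le_rpow_mul_rpow (fun i => ‖⟪b i, u⟫_𝕜‖ₑ) fun i => ‖⟪b i, v⟫_𝕜‖ₑ

lemma hasSum_inner_smul_apply (b : HilbertBasis ι 𝕜 E) (A : E →L[𝕜] G) (v : E) :
    HasSum (fun i => ⟪b i, v⟫_𝕜 • A (b i)) (A v) := by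
  simpa only [b.repr_apply_apply, map_smul] using (b.hasSum_repr v).mapL A

lemma hasSum_inner_mul_inner_apply (b : HilbertBasis ι 𝕜 E) (A : E →L[𝕜] F) (u : F) (v : E) :
    HasSum (fun i => ⟪b i, v⟫_𝕜 * ⟪u, A (b i)⟫_𝕜) ⟪u, A v⟫_𝕜 := by
  simpa only [innerSL_apply_apply, inner_smul_right] using
    (hasSum_inner_smul_apply b A v).mapL (innerSL 𝕜 u)

lemma exists_hilbertBasis_mem_of_orthogonalFamily [CompleteSpace E] {V : ι → Submodule 𝕜 E}
    [∀ i, CompleteSpace (V i)] (hV : OrthogonalFamily 𝕜 (fun i => V i) fun i => (V i).subtypeₗᵢ)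
    (hV' : (⨆ i, V i)ᗮ = ⊥) :
    ∃ (s : Set E) (b : HilbertBasis s 𝕜 E), ∀ k, ∃ i, b k ∈ V i := by
  choose w b _ using fun i => exists_hilbertBasis 𝕜 (V i)
  have orthonormal := (hV.orthonormal_sigma_orthonormal (v_family := fun i => b i)
    fun i => (b i).orthonormal).toSubtypeRange
  refine ⟨_, .mkOfOrthogonalEqBot orthonormal ?_, ?_⟩
  · rw [Subtype.range_coe]
    refine eq_bot_iff.2 fun x hx => hV' ▸ ?_
    rw [← Submodule.iInf_orthogonal, Submodule.mem_iInf]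
    refine fun i => (Submodule.mem_orthogonal' _ _).2 fun v hv => ?_
    have inner_basis_eq_zero (k) : ⟪x, (V i).subtypeL (b i k)⟫_𝕜 = 0 :=
      (Submodule.mem_orthogonal' _ _).1 hx _ (Submodule.subset_span ⟨⟨i, k⟩, rfl⟩)
    refine (hasSum_inner_mul_inner_apply (b i) (V i).subtypeL x ⟨v, hv⟩).unique ?_
    simpa only [inner_basis_eq_zero, mul_zero] using hasSum_zero
  · rintro ⟨_, ⟨i, k⟩, rfl⟩
    rw [HilbertBasis.coe_mkOfOrthogonalEqBot]
    exact ⟨i, (b i k).2⟩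

lemma opENorm_le_tsum_enorm_sq (b : HilbertBasis ι 𝕜 E) (A : E →L[𝕜] G) :
    ‖A‖ₑ ≤ (∑' i, ‖A (b i)‖ₑ ^ 2) ^ (1 / 2 : ℝ) := by
  refine A.opENorm_le_bound fun v => ?_
  calc ‖A v‖ₑ = ‖∑' i, ⟪b i, v⟫_𝕜 • A (b i)‖ₑ := by rw [(hasSum_inner_smul_apply b A v).tsum_eq]
    _ ≤ ∑' i, ‖A (b i)‖ₑ * ‖⟪b i, v⟫_𝕜‖ₑ := enorm_tsum_le_tsum_enorm.trans_eq <|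
        tsum_congr fun i => by rw [enorm_smul, mul_comm]
    _ ≤ (∑' i, ‖A (b i)‖ₑ ^ 2) ^ (1 / 2 : ℝ) * (∑' i, ‖⟪b i, v⟫_𝕜‖ₑ ^ 2) ^ (1 / 2 : ℝ) :=
        tsum_mul_le_rpow_mul_rpow _ _
    _ = (∑' i, ‖A (b i)‖ₑ ^ 2) ^ (1 / 2 : ℝ) * ‖v‖ₑ := by
        rw [tsum_enorm_inner_sq, ← ENNReal.rpow_natCast_mul]
        norm_num

lemma hasSum_rankOne_of_tsum_enorm_sq_ne_top (b : HilbertBasis ι 𝕜 E) {A : E →L[𝕜] G}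
    (hA : ∑' i, ‖A (b i)‖ₑ ^ 2 ≠ ∞) :
    HasSum (fun i => InnerProductSpace.rankOne 𝕜 (A (b i)) (b i)) A := by
  classical
  refine tendsto_iff_edist_tendsto_0.2 ?_
  have tail_tendsto : Tendsto (fun s : Finset ι =>
      (∑' i : {i // i ∉ s}, ‖A (b i)‖ₑ ^ 2) ^ (1 / 2 : ℝ)) atTop (𝓝 0) := by
    simpa using (ENNReal.tendsto_tsum_compl_atTop_zero hA).ennrpow_const (1 / 2 : ℝ)
  refine tendsto_of_tendsto_of_tendsto_of_le_of_le tendsto_const_nhds tail_tendsto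
    (fun _ => zero_le) fun s => ?_
  set T := ∑ i ∈ s, InnerProductSpace.rankOne 𝕜 (A (b i)) (b i)
  have sub_apply (i : ι) : (T - A) (b i) = if i ∈ s then 0 else -A (b i) := by
    split_ifs with hi <;> simp [T, orthonormal_iff_ite.1 b.orthonormal, hi]
  have tsum_sub : ∑' i, ‖(T - A) (b i)‖ₑ ^ 2 = ∑' i : {i // i ∉ s}, ‖A (b i)‖ₑ ^ 2 := by
    refine .trans (tsum_congr fun i => ?_) (tsum_subtype {i | i ∉ s} fun i => ‖A (b i)‖ₑ ^ 2).symm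
    by_cases hi : i ∈ s <;> simp [sub_apply, hi]
  rw [edist_eq_enorm_sub, ← tsum_sub]
  exact opENorm_le_tsum_enorm_sq b (T - A)

lemma isCompactOperator_rankOne (x : G) (y : E) :
    IsCompactOperator (InnerProductSpace.rankOne 𝕜 x y) :=
  (isCompactOperator_of_locallyCompactSpace_dom (innerSL 𝕜 y)).clm_comp
    (ContinuousLinearMap.toSpanSingleton 𝕜 x)

lemma isCompactOperator_of_tsum_enorm_sq_ne_top [CompleteSpace G] (b : HilbertBasis ι 𝕜 E)
    {A : E →L[𝕜] G} (hA : ∑' i, ‖A (b i)‖ₑ ^ 2 ≠ ∞) : IsCompactOperator A :=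
  isCompactOperator_of_tendsto (hasSum_rankOne_of_tsum_enorm_sq_ne_top b hA) <|
    .of_forall fun _ => Submodule.sum_mem (compactOperator (.id 𝕜) E G) fun _ _ =>
      isCompactOperator_rankOne _ _

lemma exists_contraction_comp_eq_of_norm_le {V : Type*} [NormedAddCommGroup V] [NormedSpace 𝕜 V]
    [CompleteSpace F] [CompleteSpace G] {T : V →L[𝕜] F} {S : V →L[𝕜] G}
    (h : ∀ x, ‖S x‖ ≤ ‖T x‖) : ∃ C : F →L[𝕜] G, ‖C‖ ≤ 1 ∧ C ∘L T = S := by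
  let M : Submodule 𝕜 F := T.range.topologicalClosure
  let e : V →ₗ[𝕜] M := (T : V →ₗ[𝕜] F).codRestrict M fun x => T.range.le_topologicalClosure ⟨x, rfl⟩
  have he : DenseRange e := by
    refine Subtype.dense_iff.2 fun y hy => ?_
    rw [← Set.range_comp]
    exact hy
  have hbound (x : V) : ‖(S : V →ₗ[𝕜] G) x‖ ≤ 1 * ‖e x‖ := (h x).trans_eq (one_mul _).symm
  refine ⟨(S : V →ₗ[𝕜] G).extendOfNorm e ∘L M.orthogonalProjectionOnto, ?_, ?_⟩
  · exact (ContinuousLinearMap.opNorm_comp_le _ _).trans <| mul_le_one₀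
      (LinearMap.opNorm_extendOfNorm_le he zero_le_one hbound) (norm_nonneg _)
      M.orthogonalProjectionOnto_norm_le
  · ext x
    have hproj : M.orthogonalProjectionOnto (T x) = e x :=
      M.orthogonalProjectionOnto_mem_subspace_eq_self (e x)
    rw [ContinuousLinearMap.comp_apply, ContinuousLinearMap.comp_apply, hproj]
    exact LinearMap.extendOfNorm_eq he ⟨1, hbound⟩ x

end HilbertSpace

section FunctionalCalculus

open Filter Topology Polynomial

lemma exists_polynomial_tendstoLocallyUniformly {φ : ℝ → ℝ} (hφ : Continuous φ) :
    ∃ P : ℕ → ℝ[X], TendstoLocallyUniformly (fun n t => (P n).eval t) φ atTop := by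
  choose P hP using fun n : ℕ => exists_polynomial_near_of_continuousOn (-n) n φ hφ.continuousOn
    (1 / ((n : ℝ) + 1)) Nat.one_div_pos_of_nat
  refine ⟨P, tendstoLocallyUniformly_iff_forall_isCompact.2 fun K hK => ?_⟩
  obtain ⟨R, hR⟩ := hK.isBounded.exists_norm_le
  refine Metric.tendstoUniformlyOn_iff.2 fun ε hε => ?_
  filter_upwards [eventually_ge_atTop ⌈R⌉₊,
    tendsto_one_div_add_atTop_nhds_zero_nat.eventually_lt_const hε] with n hn hnε t ht
  have ht' : |t| ≤ n := (hR t ht).trans (Nat.ceil_le.1 hn)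
  rw [dist_comm, Real.dist_eq]
  exact (hP n t (abs_le.1 ht')).trans hnε

lemma tendsto_aeval_cfc {A : Type*} [Ring A] [StarRing A] [TopologicalSpace A] [Algebra ℝ A]
    [ContinuousFunctionalCalculus ℝ A IsSelfAdjoint] {P : ℕ → ℝ[X]} {φ : ℝ → ℝ}
    (hP : TendstoLocallyUniformly (fun n t => (P n).eval t) φ atTop) {a : A}
    (ha : IsSelfAdjoint a) : Tendsto (fun n => aeval a (P n)) atTop (𝓝 (cfc φ a)) := by
  have hspec := tendstoLocallyUniformly_iff_forall_isCompact.1 hP (spectrum ℝ a)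
    (ContinuousFunctionalCalculus.isCompact_spectrum a)
  simpa only [cfc_polynomial _ a ha] using
    tendsto_cfc_fun hspec (.of_forall fun n => (P n).continuous.continuousOn)

variable {H : Type*} [NormedAddCommGroup H] [InnerProductSpace ℂ H]

lemma aeval_apply_of_apply_eq_smul {a : H →L[ℂ] H} {t : ℝ} {v : H} (hv : a v = t • v) (P : ℝ[X]) :
    aeval a P v = P.eval t • v := by
  induction P using Polynomial.induction_on with
  | C c => simp [Algebra.algebraMap_eq_smul_one]
  | add P Q hP hQ => simp [hP, hQ, add_smul]
  | monomial n c ih =>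
    rw [pow_succ, ← mul_assoc, map_mul, aeval_X, mul_apply_eq_comp, hv,
      ContinuousLinearMap.map_smul_of_tower, ih, smul_smul, mul_comm, eval_mul_X]

lemma cfc_apply_of_apply_eq_smul [CompleteSpace H] {φ : ℝ → ℝ} (hφ : Continuous φ) {a : H →L[ℂ] H}
    (ha : IsSelfAdjoint a) {t : ℝ} {v : H} (hv : a v = t • v) : cfc φ a v = φ t • v := by
  obtain ⟨P, hP⟩ := exists_polynomial_tendstoLocallyUniformly hφ
  have tendsto_apply : Tendsto (fun n => aeval a (P n) v) atTop (𝓝 (cfc φ a v)) :=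
    ((ContinuousLinearMap.apply ℂ H v).continuous.tendsto _).comp (tendsto_aeval_cfc hP ha)
  have tendsto_smul : Tendsto (fun n => (P n).eval t • v) atTop (𝓝 (φ t • v)) :=
    ((tendstoLocallyUniformlyOn_univ.2 hP).tendsto_at (Set.mem_univ t)).smul_const v
  refine tendsto_nhds_unique tendsto_apply ?_
  simpa only [aeval_apply_of_apply_eq_smul hv] using tendsto_smul

end FunctionalCalculus

section CompactOperator

open scoped ComplexOrder

variable {H : Type*} [NormedAddCommGroup H] [InnerProductSpace ℂ H] [CompleteSpace H]

lemma exists_hilbertBasis_eigenvectors {T : H →L[ℂ] H} (hT : IsCompactOperator T)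
    (hsa : IsSelfAdjoint T) :
    ∃ (s : Set H) (b : HilbertBasis s ℂ H), ∀ k, ∃ μ : ℂ, T (b k) = μ • b k := by
  have symm : (T : H →ₗ[ℂ] H).IsSymmetric := hsa.isSymmetric
  have (μ : ℂ) : CompleteSpace (Module.End.eigenspace (T : H →ₗ[ℂ] H) μ) :=
    (ContinuousLinearMap.isClosed_eigenspace T μ).completeSpace_coe
  obtain ⟨s, b, hb⟩ := exists_hilbertBasis_mem_of_orthogonalFamily
    symm.orthogonalFamily_eigenspaces
    (ContinuousLinearMap.orthogonalComplement_iSup_eigenspaces_eq_bot hT symm)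
  exact ⟨s, b, fun k => (hb k).imp fun _ => Module.End.mem_eigenspace_iff.1⟩

lemma exists_hilbertBasis_apply_eq_norm_smul {T : H →L[ℂ] H} (hT : IsCompactOperator T)
    (hT0 : 0 ≤ T) : ∃ (s : Set H) (b : HilbertBasis s ℂ H), ∀ k, T (b k) = ‖T (b k)‖ • b k := by
  obtain ⟨s, b, hb⟩ := exists_hilbertBasis_eigenvectors hT hT0.isSelfAdjoint
  refine ⟨s, b, fun k => ?_⟩
  obtain ⟨μ, hμ⟩ := hb k
  have eigenvalue_eq_inner : μ = ⟪b k, T (b k)⟫_ℂ := by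
    simp [hμ, inner_self_eq_norm_sq_to_K, b.orthonormal.1]
  have eigenvalue_nonneg : 0 ≤ μ := eigenvalue_eq_inner ▸
    ((ContinuousLinearMap.nonneg_iff_isPositive T).1 hT0).inner_nonneg_right (b k)
  rw [hμ, norm_smul, b.orthonormal.1, mul_one, RCLike.real_smul_eq_coe_smul (K := ℂ)]
  rw [RCLike.norm_of_nonneg' eigenvalue_nonneg]

end CompactOperator

section Schatten

variable {H : Type*} [NormedAddCommGroup H] [InnerProductSpace ℂ H] [CompleteSpace H]

lemma enorm_sqrt_apply_sq {A : H →L[ℂ] H} (hA : 0 ≤ A) (v : H) :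
    ‖CFC.sqrt A v‖ₑ ^ 2 = ENNReal.ofReal (⟪v, A v⟫_ℂ).re := by
  have inner_sqrt : ⟪CFC.sqrt A v, CFC.sqrt A v⟫_ℂ = ⟪v, A v⟫_ℂ := by
    rw [sqrt_adjoint_apply, ← mul_apply_eq_comp, CFC.sqrt_mul_sqrt_self A hA]
  rw [← ofReal_norm, ← ENNReal.ofReal_pow (norm_nonneg _), ← inner_sqrt,
    inner_self_eq_norm_sq_to_K]
  norm_cast

lemma posTr_eq_tsum {ι : Type*} (b : HilbertBasis ι ℂ H) {A : H →L[ℂ] H} (hA : 0 ≤ A) :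
    posTr A = ∑' k, ENNReal.ofReal (⟪b k, A (b k)⟫_ℂ).re := by
  simp only [posTr, ← enorm_sqrt_apply_sq hA]
  calc ∑' i, ‖CFC.sqrt A (onb H i)‖ₑ ^ 2
      = ∑' i, ∑' k, ‖⟪b k, CFC.sqrt A (onb H i)⟫_ℂ‖ₑ ^ 2 := by simp only [tsum_enorm_inner_sq]
    _ = ∑' k, ∑' i, ‖⟪onb H i, CFC.sqrt A (b k)⟫_ℂ‖ₑ ^ 2 := by
        rw [ENNReal.tsum_comm]
        refine tsum_congr fun k => tsum_congr fun i => ?_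
        rw [← sqrt_adjoint_apply, ← ofReal_norm, ← ofReal_norm, norm_inner_symm]
    _ = ∑' k, ‖CFC.sqrt A (b k)‖ₑ ^ 2 := by simp only [tsum_enorm_inner_sq]

lemma posTr_eq_one_of_mem_densityOperators {s : H →L[ℂ] H} (hs : s ∈ densityOperators H) :
    posTr s = 1 := by
  obtain ⟨hs0, hs1⟩ := hs
  have summable : Summable fun i => ⟪onb H i, s (onb H i)⟫_ℂ := by
    by_contra h
    exact zero_ne_one ((tsum_eq_zero_of_not_summable h).symm.trans hs1)
  have hasSum_re := Complex.hasSum_re summable.hasSum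
  have re_nonneg (i) : 0 ≤ (⟪onb H i, s (onb H i)⟫_ℂ).re :=
    ((ContinuousLinearMap.nonneg_iff_isPositive s).1 hs0).re_inner_nonneg_right (onb H i)
  rw [posTr, ← ENNReal.ofReal_tsum_of_nonneg re_nonneg hasSum_re.summable, hasSum_re.tsum_eq]
  change ENNReal.ofReal (tr s).re = 1
  rw [hs1, Complex.one_re, ENNReal.ofReal_one]

lemma isCompactOperator_sqrt_of_mem_densityOperators {s : H →L[ℂ] H}
    (hs : s ∈ densityOperators H) : IsCompactOperator (CFC.sqrt s : H →L[ℂ] H) := by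
  refine isCompactOperator_of_tsum_enorm_sq_ne_top (onb H) ?_
  simp only [enorm_sqrt_apply_sq hs.1]
  exact (posTr_eq_one_of_mem_densityOperators hs).trans_ne ENNReal.one_ne_top

lemma norm_abs_apply (A : H →L[ℂ] H) (v : H) : ‖CFC.abs A v‖ = ‖A v‖ := by
  refine (sq_eq_sq₀ (norm_nonneg _) (norm_nonneg _)).1 ?_
  rw [ContinuousLinearMap.apply_norm_sq_eq_inner_adjoint_right,
    ContinuousLinearMap.apply_norm_sq_eq_inner_adjoint_right,
    (CFC.abs_nonneg A).isSelfAdjoint.adjoint_eq, ← ContinuousLinearMap.star_eq_adjoint]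
  exact congrArg (fun T : H →L[ℂ] H => (⟪v, T v⟫_ℂ).re) (CFC.abs_mul_abs A)

lemma exists_contraction_mul_eq_abs (A : H →L[ℂ] H) :
    ∃ C : H →L[ℂ] H, ‖C‖ ≤ 1 ∧ C * A = CFC.abs A :=
  exists_contraction_comp_eq_of_norm_le fun v => (norm_abs_apply A v).le

lemma exists_contraction_mul_abs_eq (A : H →L[ℂ] H) :
    ∃ U : H →L[ℂ] H, ‖U‖ ≤ 1 ∧ U * CFC.abs A = A :=
  exists_contraction_comp_eq_of_norm_le fun v => (norm_abs_apply A v).ge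

lemma exists_hilbertBasis_abs_apply_eq_norm_smul {A : H →L[ℂ] H} (hA : IsCompactOperator A) :
    ∃ (s : Set H) (b : HilbertBasis s ℂ H), ∀ k, CFC.abs A (b k) = ‖A (b k)‖ • b k := by
  obtain ⟨C, -, hC⟩ := exists_contraction_mul_eq_abs A
  have isCompactOperator_abs : IsCompactOperator (CFC.abs A : H →L[ℂ] H) := hC ▸ hA.clm_comp C
  simpa only [norm_abs_apply] using
    exists_hilbertBasis_apply_eq_norm_smul isCompactOperator_abs (CFC.abs_nonneg A)

lemma eLpNorm_count_enorm_apply_le_schattenNorm {K : Type*} [MeasurableSpace K]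
    [DiscreteMeasurableSpace K] {A : H →L[ℂ] H} {b : HilbertBasis K ℂ H}
    (hb : ∀ k, CFC.abs A (b k) = ‖A (b k)‖ • b k) {p : ℝ≥0∞} (hp : p ≠ 0) :
    eLpNorm (fun k => ‖A (b k)‖ₑ) p .count ≤ schattenNorm p A := by
  rcases eq_or_ne p ∞ with rfl | hp'
  · rw [schattenNorm, if_pos rfl, eLpNorm_exponent_top]
    refine essSup_le_of_ae_le _ (.of_forall fun k => ?_)
    simpa [← ofReal_norm, b.orthonormal.1] using A.le_opENorm (b k)
  · have rpow_apply (k : K) : (CFC.abs A ^ p.toReal) (b k) = (‖A (b k)‖ ^ p.toReal) • b k := by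
      rw [CFC.rpow_eq_cfc_real (CFC.abs_nonneg A)]
      exact cfc_apply_of_apply_eq_smul (Real.continuous_rpow_const ENNReal.toReal_nonneg)
        (CFC.abs_nonneg A).isSelfAdjoint (hb k)
    have re_inner_rpow (k : K) :
        (⟪b k, (CFC.abs A ^ p.toReal) (b k)⟫_ℂ).re = ‖A (b k)‖ ^ p.toReal := by
      rw [rpow_apply, inner_smul_right_eq_smul, inner_self_eq_norm_sq_to_K, b.orthonormal.1]
      simp
    rw [schattenNorm, if_neg hp', posTr_eq_tsum b CFC.rpow_nonneg,
      eLpNorm_eq_lintegral_rpow_enorm_toReal hp hp', lintegral_count]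
    simp only [re_inner_rpow, enorm_eq_self, le_refl, ← ofReal_norm,
      ENNReal.ofReal_rpow_of_nonneg (norm_nonneg _) ENNReal.toReal_nonneg]

lemma exists_apply_hilbertBasis_eq_norm_smul {A : H →L[ℂ] H} (hA : IsCompactOperator A) :
    ∃ (s : Set H) (b : HilbertBasis s ℂ H) (U : H →L[ℂ] H), ‖U‖ ≤ 1 ∧
      (∀ k, CFC.abs A (b k) = ‖A (b k)‖ • b k) ∧ ∀ k, A (b k) = ‖A (b k)‖ • U (b k) := by
  obtain ⟨s, b, hb⟩ := exists_hilbertBasis_abs_apply_eq_norm_smul hA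
  obtain ⟨U, hU, hUA⟩ := exists_contraction_mul_abs_eq A
  refine ⟨s, b, U, hU, hb, fun k => ?_⟩
  rw [← ContinuousLinearMap.map_smul_of_tower, ← hb, ← mul_apply_eq_comp, hUA]

lemma tsum_enorm_inner_apply_mul_enorm_inner_apply_le_one {K : Type*} (y : HilbertBasis K ℂ H)
    {S T : H →L[ℂ] H} (hS : ‖S‖ ≤ 1) (hT : ‖T‖ ≤ 1) {x : H} (hx : ‖x‖ ≤ 1) :
    ∑' k, ‖⟪x, S (y k)⟫_ℂ‖ₑ * ‖⟪y k, T x⟫_ℂ‖ₑ ≤ 1 := by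
  have enorm_apply_le_one {R : H →L[ℂ] H} (hR : ‖R‖ ≤ 1) : ‖R x‖ₑ ≤ 1 := by
    rw [← ofReal_norm, ENNReal.ofReal_le_one]
    exact (R.le_of_opNorm_le hR x).trans (by simpa using hx)
  simp only [← ContinuousLinearMap.adjoint_inner_left S]
  refine (tsum_enorm_inner_mul_enorm_inner_le y _ _).trans (mul_le_one' ?_ ?_)
  · exact enorm_apply_le_one (by rwa [LinearIsometryEquiv.norm_map])
  · exact enorm_apply_le_one hT

lemma schattenNorm_one_mul_le_tsum_tsum {K L : Type*} {A B C U V : H →L[ℂ] H}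
    {y : HilbertBasis K ℂ H} {w : HilbertBasis L ℂ H} (hC : C * (A * B) = CFC.abs (A * B))
    (hU : ∀ k, A (y k) = ‖A (y k)‖ • U (y k)) (hV : ∀ l, B (w l) = ‖B (w l)‖ • V (w l)) :
    schattenNorm 1 (A * B) ≤ ∑' k, ∑' l, ‖A (y k)‖ₑ * ‖B (w l)‖ₑ *
      (‖⟪w l, (C * U) (y k)⟫_ℂ‖ₑ * ‖⟪y k, V (w l)⟫_ℂ‖ₑ) := by
  have enorm_inner_B (k : K) (l : L) :
      ‖⟪y k, B (w l)⟫_ℂ‖ₑ = ‖B (w l)‖ₑ * ‖⟪y k, V (w l)⟫_ℂ‖ₑ := by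
    conv_lhs => rw [hV, inner_smul_right_eq_smul, enorm_smul, enorm_norm]
  have enorm_inner_CA (k : K) (l : L) :
      ‖⟪w l, (C * A) (y k)⟫_ℂ‖ₑ = ‖A (y k)‖ₑ * ‖⟪w l, (C * U) (y k)⟫_ℂ‖ₑ := by
    conv_lhs => rw [mul_apply_eq_comp, hU, ContinuousLinearMap.map_smul_of_tower,
      inner_smul_right_eq_smul, enorm_smul, enorm_norm, ← mul_apply_eq_comp]
  rw [schattenNorm, if_neg ENNReal.one_ne_top, ENNReal.toReal_one, div_one, ENNReal.rpow_one,
    CFC.rpow_one _ (CFC.abs_nonneg _), posTr_eq_tsum w (CFC.abs_nonneg _), ENNReal.tsum_comm, ← hC]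
  refine ENNReal.tsum_le_tsum fun l => ?_
  calc ENNReal.ofReal (⟪w l, (C * (A * B)) (w l)⟫_ℂ).re
      ≤ ‖⟪w l, (C * A) (B (w l))⟫_ℂ‖ₑ := by
        rw [← ofReal_norm]
        exact ENNReal.ofReal_le_ofReal (Complex.re_le_norm _)
    _ ≤ ∑' k, ‖⟪y k, B (w l)⟫_ℂ * ⟪w l, (C * A) (y k)⟫_ℂ‖ₑ := by
        rw [← (hasSum_inner_mul_inner_apply y (C * A) (w l) (B (w l))).tsum_eq]
        exact enorm_tsum_le_tsum_enorm
    _ = _ := tsum_congr fun k => by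
        rw [enorm_mul, enorm_inner_B, enorm_inner_CA]
        ring

lemma schattenNorm_one_mul_le {A B : H →L[ℂ] H} (hA : IsCompactOperator A)
    (hB : IsCompactOperator B) (p q : ℝ≥0∞) [p.HolderConjugate q] :
    schattenNorm 1 (A * B) ≤ schattenNorm p A * schattenNorm q B := by
  obtain ⟨K, y, U, hU, hyA, hUA⟩ := exists_apply_hilbertBasis_eq_norm_smul hA
  obtain ⟨L, w, V, hV, hwB, hVB⟩ := exists_apply_hilbertBasis_eq_norm_smul hB
  obtain ⟨C, hC, hCAB⟩ := exists_contraction_mul_eq_abs (A * B)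
  have hCU : ‖C * U‖ ≤ 1 := (norm_mul_le C U).trans (mul_le_one₀ hC (norm_nonneg U) hU)
  let _ : MeasurableSpace K := ⊤
  let _ : MeasurableSpace L := ⊤
  calc schattenNorm 1 (A * B)
      ≤ ∑' k, ∑' l, ‖A (y k)‖ₑ * ‖B (w l)‖ₑ *
          (‖⟪w l, (C * U) (y k)⟫_ℂ‖ₑ * ‖⟪y k, V (w l)⟫_ℂ‖ₑ) :=
        schattenNorm_one_mul_le_tsum_tsum hCAB hUA hVB
    _ ≤ eLpNorm (fun k => ‖A (y k)‖ₑ) p .count * eLpNorm (fun l => ‖B (w l)‖ₑ) q .count := by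
        refine tsum_tsum_mul_mul_le_of_substochastic (fun k => ?_) (fun l => ?_) _ _ p q
        · simpa only [mul_comm] using tsum_enorm_inner_apply_mul_enorm_inner_apply_le_one w hV hCU
            (y.orthonormal.1 k).le
        · exact tsum_enorm_inner_apply_mul_enorm_inner_apply_le_one y hCU hV
            (w.orthonormal.1 l).le
    _ ≤ schattenNorm p A * schattenNorm q B := by
        gcongr
        · exact eLpNorm_count_enorm_apply_le_schattenNorm hyA
            (ENNReal.HolderConjugate.ne_zero p q)
        · exact eLpNorm_count_enorm_apply_le_schattenNorm hwB
            (ENNReal.HolderConjugate.ne_zero q p)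

end Schatten

section WeakMeasurability

open Filter Topology Polynomial TopologicalSpace
open scoped ComplexOrder InnerProduct

section RCLike

variable {𝕜 E F G : Type*} [RCLike 𝕜]
  [NormedAddCommGroup E] [InnerProductSpace 𝕜 E]
  [NormedAddCommGroup F] [InnerProductSpace 𝕜 F]
  [NormedAddCommGroup G] [InnerProductSpace 𝕜 G]

lemma countable_of_orthonormal [SeparableSpace E] {ι : Type*} {v : ι → E}
    (hv : Orthonormal 𝕜 v) : Countable ι := by
  have balls_disjoint :
      Pairwise (Function.onFun Disjoint fun i => Metric.ball (v i) (1 / 2)) := by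
    refine fun i j hij => Metric.ball_disjoint_ball ?_
    have norm_sq_eq : ‖v i - v j‖ ^ 2 = 2 := by
      rw [norm_sub_sq (𝕜 := 𝕜), hv.2 hij, hv.1, hv.1, map_zero]
      norm_num
    rw [dist_eq_norm]
    nlinarith [norm_nonneg (v i - v j)]
  exact balls_disjoint.countable_of_isOpen_disjoint (fun _ => Metric.isOpen_ball)
    fun i => ⟨v i, Metric.mem_ball_self (by norm_num)⟩

variable {X : Type*} [MeasurableSpace X]

/-- An operator-valued function is weakly measurable if all its matrix coefficients
`x ↦ ⟨u, A(x) v⟩` are measurable. Unlike measurability of the maps `x ↦ tr (s A(x))`, this notion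
involves no convergence of a trace, and so is preserved by products and limits. -/
def WeaklyMeasurable (A : X → E →L[𝕜] F) : Prop :=
  ∀ u v, Measurable fun x => ⟪u, A x v⟫_𝕜

namespace WeaklyMeasurable

lemma const (A : E →L[𝕜] F) : WeaklyMeasurable fun _ : X => A :=
  fun _ _ => measurable_const

lemma add {A B : X → E →L[𝕜] F} (hA : WeaklyMeasurable A) (hB : WeaklyMeasurable B) :
    WeaklyMeasurable fun x => A x + B x := fun u v => by
  simpa only [add_apply, inner_add_right] using (hA u v).fun_add (hB u v)

lemma const_smul {A : X → E →L[𝕜] F} (hA : WeaklyMeasurable A) (c : 𝕜) :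
    WeaklyMeasurable fun x => c • A x := fun u v => by
  simpa only [smul_apply, inner_smul_right] using (hA u v).const_mul c

lemma ite {A B : X → E →L[𝕜] F} (hA : WeaklyMeasurable A) (hB : WeaklyMeasurable B) {p : X → Prop}
    [DecidablePred p] (hp : MeasurableSet {x | p x}) :
    WeaklyMeasurable fun x => if p x then A x else B x := fun u v => by
  simpa only [apply_ite (fun T : E →L[𝕜] F => ⟪u, T v⟫_𝕜)] using (hA u v).ite hp (hB u v)

lemma of_tendsto {A : ℕ → X → E →L[𝕜] F} {B : X → E →L[𝕜] F}
    (hA : ∀ n, WeaklyMeasurable (A n)) (h : ∀ x, Tendsto (fun n => A n x) atTop (𝓝 (B x))) :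
    WeaklyMeasurable B := fun u v => by
  have coeff_continuous : Continuous fun T : E →L[𝕜] F => ⟪u, T v⟫_𝕜 := by fun_prop
  exact measurable_of_tendsto_metrizable (fun n => hA n u v)
    (tendsto_pi_nhds.2 fun x => (coeff_continuous.tendsto _).comp (h x))

lemma comp [CompleteSpace F] [SeparableSpace F] {A : X → F →L[𝕜] G} {B : X → E →L[𝕜] F}
    (hA : WeaklyMeasurable A) (hB : WeaklyMeasurable B) :
    WeaklyMeasurable fun x => A x ∘L B x := fun u v => by
  obtain ⟨s, b, -⟩ := exists_hilbertBasis 𝕜 F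
  have := countable_of_orthonormal b.orthonormal
  exact measurable_of_tendsto_metrizable' atTop
    (fun t => Finset.measurable_fun_sum t fun i _ => (hB (b i) v).mul (hA u (b i)))
    (tendsto_pi_nhds.2 fun x => hasSum_inner_mul_inner_apply b (A x) u (B x v))

lemma adjoint [CompleteSpace E] [CompleteSpace F] {A : X → E →L[𝕜] F} (hA : WeaklyMeasurable A) :
    WeaklyMeasurable fun x => (A x)† := fun u v => by
  simpa only [ContinuousLinearMap.adjoint_inner_right, Function.comp_def, inner_conj_symm] using
    RCLike.continuous_conj.measurable.comp (hA v u)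

lemma measurable_norm_apply [CompleteSpace E] [CompleteSpace F] [SeparableSpace F]
    {A : X → E →L[𝕜] F} (hA : WeaklyMeasurable A) (v : E) : Measurable fun x => ‖A x v‖ := by
  simp only [ContinuousLinearMap.apply_norm_eq_sqrt_inner_adjoint_right]
  exact (RCLike.measurable_re.comp (hA.adjoint.comp hA v v)).sqrt

lemma measurable_norm [CompleteSpace E] [CompleteSpace F] [SeparableSpace E] [SeparableSpace F]
    {A : X → E →L[𝕜] F} (hA : WeaklyMeasurable A) : Measurable fun x => ‖A x‖ := by
  have norm_le_iff {T : E →L[𝕜] F} {c : ℝ} :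
      ‖T‖ ≤ c ↔ 0 ≤ c ∧ ∀ n, ‖T (denseSeq E n)‖ ≤ c * ‖denseSeq E n‖ := by
    refine ⟨fun h => ⟨(norm_nonneg T).trans h, fun n => T.le_of_opNorm_le h _⟩,
      fun ⟨hc, h⟩ => T.opNorm_le_bound hc fun v => ?_⟩
    exact (denseRange_denseSeq E).induction_on (p := fun v => ‖T v‖ ≤ c * ‖v‖) v
      (isClosed_le (by fun_prop) (by fun_prop)) h
  refine measurable_of_Iic fun c => ?_
  simp only [Set.preimage, Set.mem_Iic, norm_le_iff, Set.ofPred_and, Set.ofPred_forall]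
  exact (MeasurableSet.const _).inter <| MeasurableSet.iInter fun n =>
    measurableSet_le (hA.measurable_norm_apply _) measurable_const

end WeaklyMeasurable

end RCLike

variable {H : Type*} [NormedAddCommGroup H] [InnerProductSpace ℂ H]
  {X : Type*} [MeasurableSpace X]

lemma nonneg_iff_forall_inner_denseSeq [CompleteSpace H] [SeparableSpace H] {T : H →L[ℂ] H} :
    0 ≤ T ↔ ∀ n, 0 ≤ ⟪T (denseSeq H n), denseSeq H n⟫_ℂ := by
  have nonneg_iff_forall : 0 ≤ T ↔ ∀ v, 0 ≤ ⟪T v, v⟫_ℂ := by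
    rw [ContinuousLinearMap.nonneg_iff_isPositive, ContinuousLinearMap.isPositive_iff_complex]
    refine forall_congr' fun v => ?_
    rw [RCLike.nonneg_iff (K := ℂ), ← RCLike.conj_eq_iff_im, RCLike.conj_eq_iff_re, and_comm]
    rfl
  refine nonneg_iff_forall.trans ⟨fun h n => h _, fun h v => ?_⟩
  exact (denseRange_denseSeq H).induction_on (p := fun v => 0 ≤ ⟪T v, v⟫_ℂ) v
    (isClosed_le (by fun_prop) (by fun_prop)) h

lemma weaklyMeasurable_of_measurable_inner_self {A : X → H →L[ℂ] H}
    (hA : ∀ v, Measurable fun x => ⟪v, A x v⟫_ℂ) : WeaklyMeasurable A := by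
  have diag_measurable (v : H) : Measurable fun x => ⟪A x v, v⟫_ℂ := by
    simpa only [Function.comp_def, inner_conj_symm] using
      Complex.continuous_conj.measurable.comp (hA v)
  intro u v
  have polarization x := inner_map_polarization (A x : H →ₗ[ℂ] H) u v
  simp only [ContinuousLinearMap.coe_coe] at polarization
  have coeff_measurable : Measurable fun x => ⟪A x v, u⟫_ℂ := by
    simp only [polarization]
    exact ((((diag_measurable _).sub (diag_measurable _)).add
      ((diag_measurable _).const_mul _)).sub ((diag_measurable _).const_mul _)).div_const _
  simpa only [Function.comp_def, inner_conj_symm] using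
    Complex.continuous_conj.measurable.comp coeff_measurable

namespace WeaklyMeasurable

variable [CompleteSpace H] [SeparableSpace H] {A B : X → H →L[ℂ] H}

lemma mul (hA : WeaklyMeasurable A) (hB : WeaklyMeasurable B) :
    WeaklyMeasurable fun x => A x * B x :=
  hA.comp hB

lemma pow (hA : WeaklyMeasurable A) (n : ℕ) : WeaklyMeasurable fun x => A x ^ n := by
  induction n with
  | zero => simpa only [pow_zero] using const 1
  | succ n ih => simpa only [pow_succ] using ih.mul hA

lemma aeval (hA : WeaklyMeasurable A) (P : ℝ[X]) :
    WeaklyMeasurable fun x => Polynomial.aeval (A x) P := by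
  induction P using Polynomial.induction_on' with
  | add P Q hP hQ => simpa only [map_add] using hP.add hQ
  | monomial n r =>
    simpa only [aeval_monomial, ← Algebra.smul_def, Complex.coe_smul] using
      (hA.pow n).const_smul (r : ℂ)

lemma cfc (hA : WeaklyMeasurable A) (hsa : ∀ x, IsSelfAdjoint (A x)) {φ : ℝ → ℝ}
    (hφ : Continuous φ) : WeaklyMeasurable fun x => _root_.cfc φ (A x) := by
  obtain ⟨P, hP⟩ := exists_polynomial_tendstoLocallyUniformly hφ
  exact of_tendsto (fun n => hA.aeval (P n)) fun x => tendsto_aeval_cfc hP (hsa x)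

lemma measurableSet_nonneg (hA : WeaklyMeasurable A) : MeasurableSet {x | 0 ≤ A x} := by
  simp only [nonneg_iff_forall_inner_denseSeq, ← ContinuousLinearMap.adjoint_inner_right,
    Set.ofPred_forall]
  exact MeasurableSet.iInter fun n => isClosed_Ici.measurableSet.preimage (hA.adjoint _ _)

lemma sqrt (hA : WeaklyMeasurable A) : WeaklyMeasurable fun x => CFC.sqrt (A x) := by
  classical
  -- `CFC.sqrt` has the junk value `0` outside the positive operators.
  have sqrt_eq_cfc (x : X) :
      CFC.sqrt (A x) = _root_.cfc Real.sqrt (if 0 ≤ A x then A x else 0) := by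
    split_ifs with hx
    · rw [CFC.sqrt_eq_real_sqrt (A x) hx, cfcₙ_eq_cfc]
    · rw [CFC.sqrt_of_not_nonneg hx, cfc_apply_zero, Real.sqrt_zero, map_zero]
  simp only [sqrt_eq_cfc]
  refine (hA.ite (const 0) hA.measurableSet_nonneg).cfc (fun x => ?_) Real.continuous_sqrt
  split_ifs with hx
  exacts [hx.isSelfAdjoint, .zero _]

lemma measurable_posTr (hA : WeaklyMeasurable A) : Measurable fun x => posTr (A x) := by
  have := countable_of_orthonormal (onb H).orthonormal
  exact Measurable.tsum fun i => (Complex.measurable_re.comp (hA _ _)).ennreal_ofReal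

lemma measurable_schattenNorm (hA : WeaklyMeasurable A) (p : ℝ≥0∞) :
    Measurable fun x => schattenNorm p (A x) := by
  unfold schattenNorm
  split_ifs with hp
  · simpa only [ofReal_norm] using hA.measurable_norm.ennreal_ofReal
  · have abs_weaklyMeasurable : WeaklyMeasurable fun x => CFC.abs (A x) := (hA.adjoint.mul hA).sqrt
    simp only [CFC.rpow_eq_cfc_real, CFC.abs_nonneg]
    exact (abs_weaklyMeasurable.cfc (fun x => (CFC.abs_nonneg (A x)).isSelfAdjoint)
      (Real.continuous_rpow_const ENNReal.toReal_nonneg)).measurable_posTr.pow_const _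

end WeaklyMeasurable

variable [CompleteSpace H]

lemma tr_rankOne_mul (u v : H) (A : H →L[ℂ] H) :
    tr (InnerProductSpace.rankOne ℂ u v * A) = ⟪v, A u⟫_ℂ := by
  simpa only [tr, mul_apply_eq_comp, InnerProductSpace.rankOne_apply, inner_smul_right,
    mul_comm] using (hasSum_inner_mul_inner_apply (onb H) A v u).tsum_eq

lemma rankOne_mem_densityOperators {u : H} (hu : ‖u‖ = 1) :
    InnerProductSpace.rankOne ℂ u u ∈ densityOperators H := by
  refine ⟨(ContinuousLinearMap.nonneg_iff_isPositive _).2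
    (InnerProductSpace.isPositive_rankOne_self u), ?_⟩
  rw [← mul_one (InnerProductSpace.rankOne ℂ u u), tr_rankOne_mul, one_apply_eq_self,
    inner_self_eq_norm_sq_to_K, hu]
  norm_num

lemma IsQuantumRandomVariable.weaklyMeasurable {f : X → H →L[ℂ] H}
    (hf : IsQuantumRandomVariable f) : WeaklyMeasurable f := by
  refine weaklyMeasurable_of_measurable_inner_self fun v => ?_
  obtain rfl | hv := eq_or_ne v 0
  · simp only [inner_zero_left, measurable_const]
  set u := NormedSpace.normalize v
  have unit_measurable : Measurable fun x => ⟪u, f x u⟫_ℂ := by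
    simpa only [tr_rankOne_mul] using
      hf _ (rankOne_mem_densityOperators (NormedSpace.norm_normalize_eq_one_iff.2 hv))
  have inner_eq (x : X) : ⟪v, f x v⟫_ℂ = (‖v‖ * ‖v‖ : ℂ) * ⟪u, f x u⟫_ℂ := by
    have v_eq : v = (‖v‖ : ℂ) • u := by rw [Complex.coe_smul, NormedSpace.norm_smul_normalize]
    conv_lhs => rw [v_eq]
    rw [map_smul, inner_smul_left, inner_smul_right, Complex.conj_ofReal, mul_assoc]
  simpa only [inner_eq] using unit_measurable.const_mul _

lemma weaklyMeasurable_of_mem_spanPositive {f : X → H →L[ℂ] H} (hf : f ∈ spanPositive X H) :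
    WeaklyMeasurable f := by
  induction hf using Submodule.span_induction with
  | mem f hf => exact hf.1.weaklyMeasurable
  | zero => exact .const 0
  | add f g _ _ hf hg => exact hf.add hg
  | smul c f _ hf => exact hf.const_smul c

end WeakMeasurability

section OperatorValuedHolder

open TopologicalSpace

variable {X : Type*} [MeasurableSpace X] {μ : Measure X} {H : Type*} [NormedAddCommGroup H]
  [InnerProductSpace ℂ H] [CompleteSpace H]

lemma eLpNorm_schattenNorm_one_mul_le [SeparableSpace H] {A B : X → H →L[ℂ] H}
    (hA : WeaklyMeasurable A) (hB : WeaklyMeasurable B)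
    (hAc : ∀ x, IsCompactOperator (A x)) (hBc : ∀ x, IsCompactOperator (B x))
    (p q : ℝ≥0∞) [p.HolderConjugate q] :
    eLpNorm (fun x => schattenNorm 1 (A x * B x)) 1 μ ≤
      eLpNorm (fun x => schattenNorm p (A x)) p μ *
        eLpNorm (fun x => schattenNorm q (B x)) q μ := by
  calc eLpNorm (fun x => schattenNorm 1 (A x * B x)) 1 μ
      = ∫⁻ x, schattenNorm 1 (A x * B x) ∂μ := by
        simp only [eLpNorm_one_eq_lintegral_enorm, enorm_eq_self]
    _ ≤ ∫⁻ x, schattenNorm p (A x) * schattenNorm q (B x) ∂μ :=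
        lintegral_mono fun x => schattenNorm_one_mul_le (hAc x) (hBc x) p q
    _ ≤ eLpNorm (fun x => schattenNorm p (A x)) p μ *
          eLpNorm (fun x => schattenNorm q (B x)) q μ :=
        lintegral_mul_le_eLpNorm_mul_eLpNorm (hA.measurable_schattenNorm p).aemeasurable
          (hB.measurable_schattenNorm q).aemeasurable p q

lemma eLpNorm_schattenNorm_le_schattenLpNorm {s : H →L[ℂ] H} (hs : s ∈ densityOperators H)
    (p q : ℝ≥0∞) (D f : X → H →L[ℂ] H) :
    eLpNorm (fun x => schattenNorm p
      (CFC.sqrt s * CFC.sqrt (D x) * f x * CFC.sqrt (D x) * CFC.sqrt s)) q μ ≤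
      schattenLpNorm p q μ D f :=
  le_iSup₂ (f := fun s (_ : s ∈ densityOperators H) => eLpNorm (fun x => schattenNorm p
    (CFC.sqrt s * CFC.sqrt (D x) * f x * CFC.sqrt (D x) * CFC.sqrt s)) q μ) s hs

end OperatorValuedHolder

end

end OpLp

open OpLp in
theorem mainTheorem12_general {X : Type*} [MeasurableSpace X] {μ : Measure X} {H : Type*}
    [NormedAddCommGroup H] [InnerProductSpace ℂ H] [CompleteSpace H]
    [TopologicalSpace.SeparableSpace H] {D f g : X → H →L[ℂ] H}
    (hD : WeaklyMeasurable D) (hf : WeaklyMeasurable f) (hg : WeaklyMeasurable g)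
    (p q : ℝ≥0∞) [p.HolderConjugate q] :
    (⨆ s ∈ densityOperators H,
      eLpNorm
        (fun x => schattenNorm 1
          (CFC.sqrt s * CFC.sqrt (D x) * f x * CFC.sqrt (D x) * s *
            CFC.sqrt (D x) * g x * CFC.sqrt (D x) * CFC.sqrt s))
        1 μ) ≤
      schattenLpNorm p p μ D f * schattenLpNorm q q μ D g := by
  refine iSup₂_le fun s hs => ?_
  let T (k : X → H →L[ℂ] H) (x : X) : H →L[ℂ] H :=
    CFC.sqrt s * CFC.sqrt (D x) * k x * CFC.sqrt (D x) * CFC.sqrt s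
  have T_weaklyMeasurable {k : X → H →L[ℂ] H} (hk : WeaklyMeasurable k) : WeaklyMeasurable (T k) :=
    ((((WeaklyMeasurable.const _).mul hD.sqrt).mul hk).mul hD.sqrt).mul (.const _)
  have T_compact (k : X → H →L[ℂ] H) (x : X) : IsCompactOperator (T k x) :=
    (isCompactOperator_sqrt_of_mem_densityOperators hs).clm_comp
      (CFC.sqrt s * CFC.sqrt (D x) * k x * CFC.sqrt (D x))
  have integrand_eq (x : X) : CFC.sqrt s * CFC.sqrt (D x) * f x * CFC.sqrt (D x) * s *
      CFC.sqrt (D x) * g x * CFC.sqrt (D x) * CFC.sqrt s = T f x * T g x := by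
    nth_rw 2 [← CFC.sqrt_mul_sqrt_self s hs.1]
    simp only [T, mul_assoc]
  simp only [integrand_eq]
  exact (eLpNorm_schattenNorm_one_mul_le (T_weaklyMeasurable hf) (T_weaklyMeasurable hg)
    (T_compact f) (T_compact g) p q).trans
    (mul_le_mul' (eLpNorm_schattenNorm_le_schattenLpNorm hs p p D f)
      (eLpNorm_schattenNorm_le_schattenLpNorm hs q q D g))

theorem mainTheorem12
    {X : Type*} [TopologicalSpace X] [LocallyCompactSpace X] [T2Space X]
    [MeasurableSpace X] [BorelSpace X]
    {H : Type*} [NormedAddCommGroup H] [InnerProductSpace ℂ H] [CompleteSpace H]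
    [TopologicalSpace.SeparableSpace H]
    (ν : OpLp.POVM X H)
    (ρ : H →L[ℂ] H) (hρ : ρ ∈ OpLp.densityOperators H) (hρ_full : Function.Injective ρ)
    {ι : Type*} (e : HilbertBasis ι ℂ H)
    (D : X → H →L[ℂ] H) (hD : ν.IsRNDeriv (ν.scalar ρ hρ) e D)
    (p q : ENNReal) (hpq : 1 / p + 1 / q = 1)
    (f g : X → H →L[ℂ] H)
    (hf : f ∈ OpLp.spanPositive X H) (hg : g ∈ OpLp.spanPositive X H) :
    (⨆ s ∈ OpLp.densityOperators H,
      MeasureTheory.eLpNorm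
        (fun x => OpLp.schattenNorm 1
          (CFC.sqrt s * CFC.sqrt (D x) * f x * CFC.sqrt (D x) * s *
            CFC.sqrt (D x) * g x * CFC.sqrt (D x) * CFC.sqrt s))
        1 (ν.scalar ρ hρ)) ≤
      OpLp.schattenLpNorm p p (ν.scalar ρ hρ) D f *
        OpLp.schattenLpNorm q q (ν.scalar ρ hρ) D g := by
  have : p.HolderConjugate q := ENNReal.holderConjugate_iff.2 (by simpa only [one_div] using hpq)
  exact mainTheorem12_general hD.isQuantumRandomVariable.weaklyMeasurable
    (OpLp.weaklyMeasurable_of_mem_spanPositive hf)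
    (OpLp.weaklyMeasurable_of_mem_spanPositive hg) p q
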